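/- Let $q,a_0\in\mathbb C\setminus\{0\}$, put $a_2=1$ and $a_1=q/a_0$ (so that $a_0a_1a_2=q$), and let $D\subset\mathbb C\setminus\{0\}$ be a set with $qc\in D$ and $q^{-1}c\in D$ for every $c\in D$. Let $\overline G_\nu$ ($\nu\in\mathbb Z$) be complex-valued functions satisfying, for all $\nu\in\mathbb Z$ and $c\in D$, $$a_0^2c^2q^{2\nu}\,\overline G_\nu(qc)+\overline G_\nu(c)=q^2\,\overline G_{\nu-1}(c),\qquad \overline G_\nu(qc)=\overline G_{\nu+1}(c)+c^2\,\overline G_{\nu+1}(qc).$$ Put $\phi_0^\nu(c)=1$ and, for $N=-M\in\mathbb Z_{<0}$, $\phi_N^\nu(c)=\det\big(\overline G_{\nu-i+j}(c)\big)_{i,j=1,\dots,M}$. (i) For all integers $N<0$ and $\nu$ and all $c\in D$ the following bilinear equations hold: $$a_0^2c^2q^{2\nu}\phi_N^\nu(qc)\phi_{N+1}^\nu(c)+\phi_N^\nu(c)\phi_{N+1}^\nu(qc)=q^{-2N}\phi_{N+1}^{\nu+1}(qc)\phi_N^{\nu-1}(c),$$ $$a_0^2q^{2\nu}\phi_N^\nu(qc)\phi_{N+1}^{\nu+1}(c)-\phi_N^\nu(c)\phi_{N+1}^{\nu+1}(qc)=(a_0^2q^{2\nu}-q^{2N})\phi_{N+1}^\nu(qc)\phi_N^{\nu+1}(c),$$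 $$\phi_{N+1}^{\nu+1}(qc)\phi_N^\nu(c)-q^{2N}\phi_{N+1}^{\nu+1}(c)\phi_N^\nu(qc)=c^2(a_0^2q^{2\nu}-q^{2N})\phi_{N+1}^\nu(c)\phi_N^{\nu+1}(qc),$$ $$\phi_N^{\nu+1}(qc)\phi_N^\nu(c)-\phi_N^{\nu+1}(c)\phi_N^\nu(qc)=-\phi_{N-1}^\nu(qc)\phi_{N+1}^{\nu+1}(c),$$ $$\phi_N^{\nu+1}(qc)\phi_N^\nu(c)-q^{2N}\phi_N^{\nu+1}(c)\phi_N^\nu(qc)=\frac1{a_0^2q^{2\nu}c^2}\phi_{N+1}^{\nu+1}(qc)\phi_{N-1}^\nu(c),$$ $$q^{2N}\phi_N^\nu(c)\phi_{N+1}^\nu(c)-\phi_{N+1}^{\nu+1}(c)\phi_N^{\nu-1}(c)=-a_0^2c^2q^{2(\nu-1)}\phi_{N+1}^\nu(q^{-1}c)\phi_N^\nu(qc),$$ $$\phi_N^\nu(c)\phi_{N+1}^{\nu+1}(c)+c^2(a_0^2q^{2\nu}-q^{2N})\phi_{N+1}^\nu(c)\phi_N^{\nu+1}(c)=q^{-2N}\phi_N^\nu(q^{-1}c)\phi_{N+1}^{\nu+1}(qc),$$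 $$a_0^2q^{2\nu}\phi_N^\nu(c)\phi_N^{\nu+1}(c)+\phi_{N+1}^{\nu+1}(c)\phi_{N-1}^\nu(c)=a_0^2q^{2\nu}\phi_N^{\nu+1}(q^{-1}c)\phi_N^\nu(qc).$$ (ii) For integers $N<0$ and $\nu$ put $$f_0(c)=a_0q^\nu c^2\frac{\phi_{N+1}^\nu(c)\phi_N^\nu(qc)}{\phi_{N+1}^\nu(qc)\phi_N^\nu(c)},\quad f_1(c)=-\frac1{a_0q^{\nu+N-1}}\frac{\phi_{N+1}^\nu(qc)\phi_N^{\nu-1}(c)}{\phi_{N+1}^\nu(c)\phi_N^{\nu-1}(qc)},\quad f_2(c)=-q^N\frac{\phi_N^{\nu-1}(qc)\phi_N^\nu(c)}{\phi_N^\nu(qc)\phi_N^{\nu-1}(c)}.$$ Let $c\in D$ be such that the denominators of $f_0,f_1,f_2$ at $c$ and at $qc$ do not vanish, i.e. $\phi_{N+1}^\nu,\phi_N^\nu,\phi_N^{\nu-1}$ are nonzero at $c$, $qc$ and $q^2c$. Then $f_0(c)f_1(c)f_2(c)=qc^2$, the denominators on the right-hand sides below are nonzero, and $f_0,f_1,f_2$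 satisfy the $q$-Painlevé IV system $$f_0(qc)=a_0a_1q^Nf_1(c)\frac{1+a_2q^{-N}f_2(c)+a_2a_0q^{\nu-N}f_2(c)f_0(c)}{1+a_0q^\nu f_0(c)+a_0a_1q^Nf_0(c)f_1(c)},$$ $$f_1(qc)=a_1a_2q^{-\nu}f_2(c)\frac{1+a_0q^\nu f_0(c)+a_0a_1q^Nf_0(c)f_1(c)}{1+a_1q^{-\nu+N}f_1(c)+a_1a_2q^{-\nu}f_1(c)f_2(c)},$$ $$f_2(qc)=a_2a_0q^{\nu-N}f_0(c)\frac{1+a_1q^{-\nu+N}f_1(c)+a_1a_2q^{-\nu}f_1(c)f_2(c)}{1+a_2q^{-N}f_2(c)+a_2a_0q^{\nu-N}f_2(c)f_0(c)}.$$ -/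

import Mathlib

namespace QPIV

/-- The contiguity relations satisfied by `G = (G_ν)_ν` on the set `D`, for all integers `ν`. -/
structure ContiguityRelations (q a₀ : ℂ) (D : Set ℂ) (G : ℤ → ℂ → ℂ) : Prop where
  cn1 : ∀ (ν : ℤ), ∀ c ∈ D,
    a₀ ^ 2 * c ^ 2 * q ^ (2 * ν) * G ν (q * c) + G ν c = q ^ 2 * G (ν - 1) c
  cn2 : ∀ (ν : ℤ), ∀ c ∈ D,
    G ν (q * c) = G (ν + 1) c + c ^ 2 * G (ν + 1) (q * c)

/-- The Toeplitz determinant `φ_N^ν(c) = det (G_{ν-i+j}(c))_{i,j=1,…,M}` for `N = -M ≤ 0`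
(the empty determinant, `1`, for `N = 0`). It is meant, and used below, only for `N ≤ 0`. -/
noncomputable def phi (G : ℤ → ℂ → ℂ) (N ν : ℤ) (c : ℂ) : ℂ :=
  (Matrix.of fun i j : Fin (-N).toNat => G (ν - (i : ℕ) + (j : ℕ)) c).det

/-- The eight bilinear equations for a family `φ N ν c`, at given `N`, `ν`, `c`. -/
structure BilinearEquations (q a₀ : ℂ) (φ : ℤ → ℤ → ℂ → ℂ) (N ν : ℤ) (c : ℂ) : Prop where
  bl1 : a₀ ^ 2 * c ^ 2 * q ^ (2 * ν) * φ N ν (q * c) * φ (N + 1) ν c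
      + φ N ν c * φ (N + 1) ν (q * c)
    = q ^ (-2 * N) * φ (N + 1) (ν + 1) (q * c) * φ N (ν - 1) c
  bl2 : a₀ ^ 2 * q ^ (2 * ν) * φ N ν (q * c) * φ (N + 1) (ν + 1) c
      - φ N ν c * φ (N + 1) (ν + 1) (q * c)
    = (a₀ ^ 2 * q ^ (2 * ν) - q ^ (2 * N)) * φ (N + 1) ν (q * c) * φ N (ν + 1) c
  bl2_aux : φ (N + 1) (ν + 1) (q * c) * φ N ν c
      - q ^ (2 * N) * φ (N + 1) (ν + 1) c * φ N ν (q * c)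
    = c ^ 2 * (a₀ ^ 2 * q ^ (2 * ν) - q ^ (2 * N)) * φ (N + 1) ν c * φ N (ν + 1) (q * c)
  bl3 : φ N (ν + 1) (q * c) * φ N ν c - φ N (ν + 1) c * φ N ν (q * c)
    = -(φ (N - 1) ν (q * c) * φ (N + 1) (ν + 1) c)
  bl3_aux : φ N (ν + 1) (q * c) * φ N ν c - q ^ (2 * N) * φ N (ν + 1) c * φ N ν (q * c)
    = 1 / (a₀ ^ 2 * q ^ (2 * ν) * c ^ 2) * φ (N + 1) (ν + 1) (q * c) * φ (N - 1) ν c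
  bl4 : q ^ (2 * N) * φ N ν c * φ (N + 1) ν c - φ (N + 1) (ν + 1) c * φ N (ν - 1) c
    = -(a₀ ^ 2 * c ^ 2 * q ^ (2 * (ν - 1)) * φ (N + 1) ν (q⁻¹ * c) * φ N ν (q * c))
  bl5 : φ N ν c * φ (N + 1) (ν + 1) c
      + c ^ 2 * (a₀ ^ 2 * q ^ (2 * ν) - q ^ (2 * N)) * φ (N + 1) ν c * φ N (ν + 1) c
    = q ^ (-2 * N) * φ N ν (q⁻¹ * c) * φ (N + 1) (ν + 1) (q * c)
  bl6 : a₀ ^ 2 * q ^ (2 * ν) * φ N ν c * φ N (ν + 1) c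
      + φ (N + 1) (ν + 1) c * φ (N - 1) ν c
    = a₀ ^ 2 * q ^ (2 * ν) * φ N (ν + 1) (q⁻¹ * c) * φ N ν (q * c)

/-- `f₀(c; ν, N)`. -/
noncomputable def f0 (q a₀ : ℂ) (φ : ℤ → ℤ → ℂ → ℂ) (N ν : ℤ) (c : ℂ) : ℂ :=
  a₀ * q ^ ν * c ^ 2 *
    ((φ (N + 1) ν c * φ N ν (q * c)) / (φ (N + 1) ν (q * c) * φ N ν c))

/-- `f₁(c; ν, N)`. -/
noncomputable def f1 (q a₀ : ℂ) (φ : ℤ → ℤ → ℂ → ℂ) (N ν : ℤ) (c : ℂ) : ℂ :=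
  -(1 / (a₀ * q ^ (ν + N - 1))) *
    ((φ (N + 1) ν (q * c) * φ N (ν - 1) c) / (φ (N + 1) ν c * φ N (ν - 1) (q * c)))

/-- `f₂(c; ν, N)`. -/
noncomputable def f2 (q : ℂ) (φ : ℤ → ℤ → ℂ → ℂ) (N ν : ℤ) (c : ℂ) : ℂ :=
  -q ^ N *
    ((φ N (ν - 1) (q * c) * φ N ν c) / (φ N ν (q * c) * φ N (ν - 1) c))

/-- The functions `g₀, g₁, g₂` satisfy the `q`-Painlevé IV system with parameters
`a₀ q^ν, a₁ q^{-ν+N}, a₂ q^{-N}` at the point `c`. The denominators of the system are required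
to be nonzero, and the normalization `g₀ g₁ g₂ = q c²` relating the dependent variables to the
independent variable `c` is included. -/
structure SatisfiesQPIV (q a₀ a₁ a₂ : ℂ) (N ν : ℤ) (g₀ g₁ g₂ : ℂ → ℂ) (c : ℂ) : Prop where
  den0 : 1 + a₀ * q ^ ν * g₀ c + a₀ * a₁ * q ^ N * g₀ c * g₁ c ≠ 0
  den1 : 1 + a₁ * q ^ (-ν + N) * g₁ c + a₁ * a₂ * q ^ (-ν) * g₁ c * g₂ c ≠ 0
  den2 : 1 + a₂ * q ^ (-N) * g₂ c + a₂ * a₀ * q ^ (ν - N) * g₂ c * g₀ c ≠ 0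
  eq0 : g₀ (q * c) = a₀ * a₁ * q ^ N * g₁ c *
    ((1 + a₂ * q ^ (-N) * g₂ c + a₂ * a₀ * q ^ (ν - N) * g₂ c * g₀ c) /
      (1 + a₀ * q ^ ν * g₀ c + a₀ * a₁ * q ^ N * g₀ c * g₁ c))
  eq1 : g₁ (q * c) = a₁ * a₂ * q ^ (-ν) * g₂ c *
    ((1 + a₀ * q ^ ν * g₀ c + a₀ * a₁ * q ^ N * g₀ c * g₁ c) /
      (1 + a₁ * q ^ (-ν + N) * g₁ c + a₁ * a₂ * q ^ (-ν) * g₁ c * g₂ c))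
  eq2 : g₂ (q * c) = a₂ * a₀ * q ^ (ν - N) * g₀ c *
    ((1 + a₁ * q ^ (-ν + N) * g₁ c + a₁ * a₂ * q ^ (-ν) * g₁ c * g₂ c) /
      (1 + a₂ * q ^ (-N) * g₂ c + a₂ * a₀ * q ^ (ν - N) * g₂ c * g₀ c))
  normalization : g₀ c * g₁ c * g₂ c = q * c ^ 2

end QPIV

/-! Fix `c` and write `x k`, `y k`, `z k` for `G k` at `c`, `q * c`, `q⁻¹ * c`, with `p = q⁻²`, `α =
a₀²`, `d = c²`. The contiguity relations then say that `α d y` is the neighbour difference of `p ^ k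
* x k`, and that `x k = y (k - 1) - d * y k`; the same holds for `z, x, p d` in place of `x, y, d`.
The weight `p ^ k` changes a Toeplitz determinant only by a power of `p`, so the equations concern
Toeplitz determinants of a sequence `u` and of its difference `v k = u (k - 1) - s * u k`.

Row operations turn all rows but one of the determinant of `u` into rows of `v`. Bordering by a
geometric row lowers the size by one and applies a second difference operator to every row.
Determinants of neighbouring sizes thus become brackets with a common block of rows of `v`, and
three-term Plücker relations give `toeplitzDet_bilinear` and `toeplitzDet_bilinear_three`. Choosing
the two operators gives every bilinear equation except `bl5`, directly or by a linear combination.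
`bl5` rests on `toeplitzDet_semiclassical`, where a double sum over cofactors is evaluated in two
ways.

For the Painlevé system, two bilinear equations at a time collapse each of the three denominators to
a single monomial in values of `φ`. The equations are then identities between monomials. -/

namespace QPIV

open Matrix

/-! ### Plücker relations for determinants with two distinguished rows. -/

variable {K : Type*} [Field K]

/-- The three-term Plücker relation, with one of the two factors of each product replaced by a
linear functional vanishing on the common rows. -/
theorem det_mul_linearMap_eq {ι : Type*} [Fintype ι] [DecidableEq ι] (A : Matrix ι ι K)
    {p q : ι} (hpq : p ≠ q) (d : ι → K) (f : (ι → K) →ₗ[K] K)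
    (hf : ∀ i, i ≠ p → i ≠ q → f (A i) = 0) :
    A.det * f d = (A.updateRow p d).det * f (A p) + (A.updateRow q d).det * f (A q) := by
  have h : ∑ i, (A.updateRow i d).det • A i = A.det • d := by
    have h1 := mulVec_cramer Aᵀ d
    rw [det_transpose] at h1
    rw [← h1]
    ext j
    simp [mulVec, dotProduct, cramer_transpose_apply, mul_comm]
  have h2 := congrArg f h
  rw [map_sum, map_smul, smul_eq_mul] at h2
  rw [← h2, ← Finset.sum_subset (Finset.subset_univ {p, q}), Finset.sum_pair hpq]
  · simp
  · intro i _ hi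
    simp only [Finset.mem_insert, Finset.mem_singleton, not_or] at hi
    simp [hf i hi.1 hi.2]

/-- The determinant with first row `x`, last row `y` and the rows `C` in between. -/
def bracket {k : ℕ} (C : Fin k → Fin (k + 2) → K) (x y : Fin (k + 2) → K) : K :=
  (of (Fin.cons x (Fin.snoc C y : Fin (k + 1) → Fin (k + 2) → K) :
    Fin (k + 2) → Fin (k + 2) → K)).det

/-- The map `w ↦ bracket C w f` is linear and kills the rows of `C`, so `det_mul_linearMap_eq`
applies to the matrix with rows `b, C, a` and leaves only the terms of its outer rows. -/
theorem bracket_plucker {k : ℕ} (C : Fin k → Fin (k + 2) → K) (a b e f : Fin (k + 2) → K) :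
    bracket C b a * bracket C e f = bracket C e a * bracket C b f
      + bracket C b e * bracket C a f := by
  let A : Matrix (Fin (k + 2)) (Fin (k + 2)) K :=
    of (Fin.cons b (Fin.snoc C a : Fin (k + 1) → Fin (k + 2) → K))
  let F : Matrix (Fin (k + 2)) (Fin (k + 2)) K :=
    of (Fin.cons b (Fin.snoc C f : Fin (k + 1) → Fin (k + 2) → K))
  let g : (Fin (k + 2) → K) →ₗ[K] K := detRowAlternating.toMultilinearMap.toLinearMap F 0
  have hg : ∀ w, g w = bracket C w f := by
    intro w
    change det (F.updateRow 0 w) = _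
    unfold bracket
    congr 1
    ext i j
    refine Fin.cases ?_ (fun i => ?_) i
    · simp
    · simp [F, updateRow_apply]
  have h := det_mul_linearMap_eq A (p := 0) (q := Fin.last (k + 1)) (by simp [Fin.ext_iff]) e g ?_
  · rw [hg, hg, hg] at h
    have h0 : A 0 = b := rfl
    have h1 : A (Fin.last (k + 1)) = a := by
      ext j
      simp [A, ← Fin.succ_last]
    rw [h0, h1] at h
    have h2 : (A.updateRow 0 e).det = bracket C e a := by
      unfold bracket
      congr 1
      ext i j
      refine Fin.cases ?_ (fun i => ?_) i
      · simp
      · simp [A, updateRow_apply]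
    have h3 : (A.updateRow (Fin.last (k + 1)) e).det = bracket C b e := by
      unfold bracket
      congr 1
      ext i j
      refine Fin.cases ?_ (fun i => Fin.lastCases ?_ (fun i => ?_) i) i
      · simp [A, updateRow_apply, Fin.ext_iff]
      · simp [updateRow_apply]
      · simp [A, updateRow_apply, Fin.ext_iff, i.2.ne]
    rw [h2, h3] at h
    exact h
  · intro i hi0 hil
    rw [hg]
    obtain ⟨i, rfl⟩ := Fin.exists_succ_eq.mpr hi0
    obtain ⟨i, rfl⟩ := Fin.exists_castSucc_eq.mpr (fun h : i = Fin.last k => hil (by simp [h]))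
    refine det_zero_of_row_eq (i := 0) (j := i.castSucc.succ) (Fin.succ_ne_zero _).symm ?_
    ext j
    simp [A]

theorem bracket_swap {k : ℕ} (C : Fin k → Fin (k + 2) → K) (x y : Fin (k + 2) → K) :
    bracket C x y = -bracket C y x := by
  have h := (detRowAlternating (R := K) (n := Fin (k + 2))).map_swap
    (Fin.cons y (Fin.snoc C x : Fin (k + 1) → Fin (k + 2) → K)) (i := 0) (j := (Fin.last k).succ)
    (Fin.succ_ne_zero _).symm
  unfold bracket
  refine Eq.trans ?_ h
  congr 1
  ext i j
  refine Fin.cases ?_ (fun i => Fin.lastCases ?_ (fun i => ?_) i) i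
  · simp
  · simp
  · rw [Function.comp_apply, Equiv.swap_apply_of_ne_of_ne (Fin.succ_ne_zero _)]
    · simp
    · simp [Fin.ext_iff, i.2.ne]

/-- Moving the first argument to the end is a cycle of length `k + 1`, of sign `(-1) ^ k`. An
arbitrary alternating map is allowed so that the determinant with its first row frozen is covered
too. -/
theorem map_cons_eq_map_snoc {V N : Type*} [AddCommGroup V] [Module K V] [AddCommGroup N]
    [Module K N] {k : ℕ} (g : V [⋀^Fin (k + 1)]→ₗ[K] N) (a : V) (C : Fin k → V) :
    g (Fin.snoc C a) = (-1 : K) ^ k • g (Fin.cons a C) := by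
  have := g.map_perm (Fin.cons a C) (finRotate (k + 1))
  rw [Fin.snoc_eq_cons_rotate]
  rw [sign_finRotate] at this
  refine Eq.trans this ?_
  rw [Units.smul_def]
  rcases Nat.even_or_odd k with h | h <;> simp [h.neg_one_pow]

theorem det_snoc_eq {k : ℕ} (a : Fin (k + 1) → K) (C : Fin k → Fin (k + 1) → K) :
    (of (Fin.snoc C a : Fin (k + 1) → Fin (k + 1) → K)).det
      = (-1) ^ k * (of (Fin.cons a C : Fin (k + 1) → Fin (k + 1) → K)).det :=
  map_cons_eq_map_snoc detRowAlternating a C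

theorem det_cons_snoc_eq {k : ℕ} (x a : Fin (k + 2) → K) (C : Fin k → Fin (k + 2) → K) :
    bracket C x a
      = (-1) ^ k * (of (Fin.cons x (Fin.cons a C : Fin (k + 1) → Fin (k + 2) → K) :
          Fin (k + 2) → Fin (k + 2) → K)).det :=
  map_cons_eq_map_snoc (detRowAlternating.curryLeft x) a C

/-! ### Bordering by a geometric row. -/

/-- Appending the geometric row `a ^ j * r ^ (n - j)` amounts to combining neighbouring columns. -/
theorem det_snoc_geom {n : ℕ} (W : Fin n → Fin (n + 1) → K) (a r : K) :
    (of (Fin.snoc W (fun j => a ^ (j : ℕ) * r ^ (n - j)) : Fin (n + 1) → Fin (n + 1) → K)).det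
      = (of fun i j : Fin n => a * W i j.castSucc - r * W i j.succ).det := by
  -- For `a = 0` the column operation below is singular, but the geometric row is `r ^ n` times the
  -- first unit vector and can be expanded directly.
  by_cases ha : a = 0
  · subst ha
    rw [det_succ_row _ (Fin.last n), Fin.sum_univ_succ, Finset.sum_eq_zero]
    · have : (of fun i j : Fin n => 0 * W i j.castSucc - r * W i j.succ)
          = (-r) • (of fun i j : Fin n => W i j.succ) := by
        ext i j; simp
      rw [this, det_smul]
      have hs : (of (Fin.snoc W (fun j => (0 : K) ^ (j : ℕ) * r ^ (n - j)) :
          Fin (n + 1) → Fin (n + 1) → K)).submatrix (Fin.last n).succAbove (Fin.succAbove 0)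
          = of fun i j : Fin n => W i j.succ := by
        ext i j; simp
      rw [hs]
      simp only [Fin.val_last, Fin.val_zero, add_zero, of_apply, Fin.snoc_last, pow_zero, one_mul,
        Nat.sub_zero, Fintype.card_fin]
      rw [neg_pow r]
    · intro j _; simp
  -- Right multiplication by `L` combines neighbouring columns and fixes the last one. It turns the
  -- geometric row into `(0, …, 0, a ^ n)`, and `a ^ n` is also `L.det`.
  · let L : Matrix (Fin (n + 1)) (Fin (n + 1)) K := of fun i j =>
      Fin.lastCases (motive := fun _ => K) (if i = Fin.last n then 1 else 0)
        (fun j => (if i = j.castSucc then a else 0) + (if i = j.succ then -r else 0)) j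
    let A : Matrix (Fin (n + 1)) (Fin (n + 1)) K :=
      of (Fin.snoc W (fun j => a ^ (j : ℕ) * r ^ (n - j)) : Fin (n + 1) → Fin (n + 1) → K)
    have hL : L.det = a ^ n := by
      rw [det_of_isLowerTriangular]
      · rw [Fin.prod_univ_castSucc]
        simp [L, Fin.ext_iff]
      · intro i j hij
        simp only [OrderDual.toDual_lt_toDual] at hij
        revert hij
        refine Fin.lastCases ?_ (fun j => ?_) j
        · intro hij; simp [L, hij.ne]
        · intro hij
          have h1 : i ≠ j.castSucc := hij.ne
          have h2 : i ≠ j.succ := fun h => by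
            subst h; simp [Fin.lt_def] at hij
          simp [L, h1, h2]
    have hAL : ∀ i (j : Fin n), (A * L) i j.castSucc = a * A i j.castSucc - r * A i j.succ := by
      intro i j
      simp [mul_apply, L, mul_add, Finset.sum_add_distrib]
      ring
    have hAl : (A * L) (Fin.last n) (Fin.last n) = a ^ n := by
      simp [mul_apply, L, A]
    have hdet : (A * L).det
        = a ^ n * (of fun i j : Fin n => a * W i j.castSucc - r * W i j.succ).det := by
      rw [det_succ_row _ (Fin.last n), Fin.sum_univ_castSucc, Finset.sum_eq_zero, hAl]
      · simp only [zero_add, Fin.val_last, Fin.succAbove_last]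
        rw [← two_mul, pow_mul]
        simp only [even_two, Even.neg_pow, one_pow, one_mul]
        congr 2
        ext i j
        simp [hAL, A]
      · intro j _
        have : (A * L) (Fin.last n) j.castSucc = 0 := by
          rw [hAL]
          have : n - (j : ℕ) = (n - (j + 1)) + 1 := by omega
          simp [A, this]
          ring
        simp [this]
    rw [det_mul, hL, mul_comm] at hdet
    exact mul_left_cancel₀ (pow_ne_zero n ha) hdet

/-! ### Toeplitz determinants: rescaling and cutting. -/

/-- The Toeplitz determinant `det (u (ν - i + j))` of size `M`. -/
def toeplitzDet (u : ℤ → K) (ν : ℤ) (M : ℕ) : K :=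
  (of fun i j : Fin M => u (ν - (i : ℕ) + (j : ℕ))).det

/-- The row `u k, u (k + 1), …, u (k + n - 1)`. -/
def shiftRow (u : ℤ → K) (k : ℤ) (n : ℕ) : Fin n → K := fun j => u (k + (j : ℕ))

/-- The row whose `j`-th entry is `a ^ j * r ^ (n - j)`. -/
def geomRow (a r : K) (n : ℕ) : Fin (n + 1) → K := fun j => a ^ (j : ℕ) * r ^ (n - j)

/-- The combination of neighbouring entries of a row that annihilates `geomRow a r n`. -/
def cutRow (a r : K) {n : ℕ} (w : Fin (n + 1) → K) : Fin n → K :=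
  fun j => a * w j.castSucc - r * w j.succ

theorem toeplitzDet_zero (u : ℤ → K) (ν : ℤ) : toeplitzDet u ν 0 = 1 := det_isEmpty

theorem toeplitzDet_one (u : ℤ → K) (ν : ℤ) : toeplitzDet u ν 1 = u ν := by
  simp [toeplitzDet]

theorem toeplitzDet_shift (u : ℤ → K) (ν d : ℤ) (M : ℕ) :
    toeplitzDet (fun k => u (k + d)) ν M = toeplitzDet u (ν + d) M := by
  unfold toeplitzDet
  congr 1
  ext i j
  simp only [of_apply]
  congr 1
  ring

theorem toeplitzDet_const_mul (u : ℤ → K) (t : K) (ν : ℤ) (M : ℕ) :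
    toeplitzDet (fun k => t * u k) ν M = t ^ M * toeplitzDet u ν M := by
  have := det_smul (of fun i j : Fin M => u (ν - (i : ℕ) + (j : ℕ))) t
  rw [Fintype.card_fin] at this
  exact this

/-- The weight `p ^ (ν - i + j)` splits into a row factor and a column factor; over the whole matrix
the contributions of `i` and `j` cancel. -/
theorem toeplitzDet_zpow_mul (u : ℤ → K) {p : K} (hp : p ≠ 0) (ν : ℤ) (M : ℕ) :
    toeplitzDet (fun k => p ^ k * u k) ν M = p ^ (ν * M) * toeplitzDet u ν M := by
  let A : Matrix (Fin M) (Fin M) K := of fun i j => u (ν - (i : ℕ) + (j : ℕ))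
  have h : (of fun i j : Fin M => p ^ (ν - (i : ℕ) + (j : ℕ)) * u (ν - (i : ℕ) + (j : ℕ)))
      = of fun i j : Fin M => p ^ (ν - (i : ℕ)) *
        (of fun i j : Fin M => p ^ ((j : ℕ) : ℤ) * A i j) i j := by
    ext i j
    simp [A, zpow_add₀ hp, mul_assoc]
  unfold toeplitzDet
  rw [h, det_mul_column, det_mul_row, ← mul_assoc, ← Finset.prod_mul_distrib]
  congr 1
  rw [Finset.prod_congr rfl (g := fun _ => p ^ ν)]
  · simp [_root_.zpow_mul]
  · intro i _
    rw [← zpow_add₀ hp]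
    congr 1
    ring

theorem cutRow_shiftRow {u u' : ℤ → K} {a r : K} (hu' : ∀ k, u' k = a * u (k - 1) - r * u k)
    (k : ℤ) (n : ℕ) : cutRow a r (shiftRow u k (n + 1)) = shiftRow u' (k + 1) n := by
  ext j
  simp only [cutRow, shiftRow, hu', Fin.val_castSucc, Fin.val_succ, Nat.cast_add, Nat.cast_one]
  congr 3 <;> ring

theorem det_snoc_geomRow {n : ℕ} (W : Fin n → Fin (n + 1) → K) (a r : K) :
    (of (Fin.snoc W (geomRow a r n) : Fin (n + 1) → Fin (n + 1) → K)).det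
      = (of fun i => cutRow a r (W i)).det :=
  det_snoc_geom W a r

theorem bracket_geomRow {k : ℕ} (C : Fin k → Fin (k + 2) → K) (x : Fin (k + 2) → K) (a r : K) :
    bracket C x (geomRow a r (k + 1))
      = (of (Fin.cons (cutRow a r x) (fun i => cutRow a r (C i)) :
          Fin (k + 1) → Fin (k + 1) → K)).det := by
  unfold bracket
  rw [Fin.cons_snoc_eq_snoc_cons, det_snoc_geomRow]
  congr 1
  ext i j
  refine Fin.cases ?_ (fun i => ?_) i <;> simp

/-! ### Bilinear identities from a sequence and its difference. -/

section Telescoping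

variable {u v u' v' : ℤ → K} {s a r : K}

/-- Row reduction of a Toeplitz determinant. -/
theorem det_cons_shiftRow (hv : ∀ k, v k = u (k - 1) - s * u k) (ν : ℤ) (n : ℕ) :
    (of (Fin.cons (shiftRow u ν (n + 1)) (fun i : Fin n => shiftRow v (ν - (i : ℕ)) (n + 1)) :
      Fin (n + 1) → Fin (n + 1) → K)).det = toeplitzDet u ν (n + 1) := by
  refine (det_eq_of_forall_row_eq_smul_add_pred (fun _ => s) (fun j => ?_) (fun i j => ?_)).symm
  · simp [shiftRow]
  · simp only [of_apply, Fin.cons_succ, shiftRow, hv, Fin.val_castSucc, Fin.val_succ, Nat.cast_add,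
      Nat.cast_one]
    have : ν - ((i : ℕ) + 1 : ℤ) + (j : ℕ) = ν - (i : ℕ) + (j : ℕ) - 1 := by ring
    rw [this]
    ring

/-- The two difference operators have constant coefficients, hence commute. -/
theorem cut_telescope (hv : ∀ k, v k = u (k - 1) - s * u k)
    (hu' : ∀ k, u' k = a * u (k - 1) - r * u k) (hv' : ∀ k, v' k = a * v (k - 1) - r * v k)
    (k : ℤ) : v' k = u' (k - 1) - s * u' k := by
  rw [hv', hu', hu', hv, hv]
  ring

theorem bracket_shiftRow_last (hv' : ∀ k, v' k = a * v (k - 1) - r * v k) (ν : ℤ) (k : ℕ) :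
    bracket (fun i : Fin k => shiftRow v (ν - (i : ℕ)) (k + 2)) (shiftRow v (ν - k) (k + 2))
      (geomRow a r (k + 1)) = (-1) ^ k * toeplitzDet v' (ν + 1) (k + 1) := by
  rw [bracket_geomRow, cutRow_shiftRow hv']
  simp only [cutRow_shiftRow hv']
  have h := det_snoc_eq (shiftRow v' (ν - k + 1) (k + 1))
    (fun i : Fin k => shiftRow v' (ν - (i : ℕ) + 1) (k + 1))
  have h2 : (of (Fin.snoc (fun i : Fin k => shiftRow v' (ν - (i : ℕ) + 1) (k + 1))
      (shiftRow v' (ν - k + 1) (k + 1)) : Fin (k + 1) → Fin (k + 1) → K)).det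
      = toeplitzDet v' (ν + 1) (k + 1) := by
    unfold toeplitzDet
    congr 1
    ext i j
    refine Fin.lastCases ?_ (fun i => ?_) i <;> simp [shiftRow] <;> congr 1 <;> ring
  rw [← h2, h, ← mul_assoc, ← mul_pow]
  simp

theorem bracket_shiftRow_head (hv : ∀ k, v k = u (k - 1) - s * u k)
    (hu' : ∀ k, u' k = a * u (k - 1) - r * u k) (hv' : ∀ k, v' k = a * v (k - 1) - r * v k)
    (ν : ℤ) (k : ℕ) :
    bracket (fun i : Fin k => shiftRow v (ν - (i : ℕ)) (k + 2)) (shiftRow u ν (k + 2))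
      (geomRow a r (k + 1)) = toeplitzDet u' (ν + 1) (k + 1) := by
  rw [bracket_geomRow, cutRow_shiftRow hu']
  simp only [cutRow_shiftRow hv']
  rw [← det_cons_shiftRow (cut_telescope hv hu' hv')]
  congr 4
  ext i
  congr 1
  ring

theorem bracket_shiftRow_full (hv : ∀ k, v k = u (k - 1) - s * u k) (ν : ℤ) (k : ℕ) :
    bracket (fun i : Fin k => shiftRow v (ν - (i : ℕ)) (k + 2)) (shiftRow u ν (k + 2))
      (shiftRow v (ν - k) (k + 2)) = toeplitzDet u ν (k + 2) := by
  rw [← det_cons_shiftRow hv]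
  unfold bracket
  congr 3
  ext i j
  refine Fin.lastCases ?_ (fun i => ?_) i <;> simp

/-- A bilinear identity relating Toeplitz determinants of sizes `M + 1` and `M`. -/
theorem toeplitzDet_bilinear (hv : ∀ k, v k = u (k - 1) - s * u k)
    (hu' : ∀ k, u' k = a * u (k - 1) - r * u k) (hv' : ∀ k, v' k = a * v (k - 1) - r * v k)
    (ν : ℤ) (M : ℕ) :
    toeplitzDet v ν (M + 1) * toeplitzDet u' ν M + s * (toeplitzDet u ν (M + 1) *
      toeplitzDet v' ν M) = toeplitzDet u (ν - 1) (M + 1) * toeplitzDet v' (ν + 1) M := by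
  obtain _ | k := M
  · simp only [zero_add, toeplitzDet_one, toeplitzDet_zero, hv]
    ring
  let C : Fin k → Fin (k + 2) → K := fun i => shiftRow v (ν - 1 - (i : ℕ)) (k + 2)
  have hba : bracket C (shiftRow v ν (k + 2)) (shiftRow v (ν - 1 - k) (k + 2))
      = toeplitzDet v ν (k + 2) := by
    unfold bracket toeplitzDet
    congr 1
    ext i j
    refine Fin.cases ?_ (fun i => Fin.lastCases ?_ (fun i => ?_) i) i <;>
      simp [C, shiftRow] <;> congr 1 <;> ring
  have hce := bracket_shiftRow_head hv hu' hv' (ν - 1) k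
  have hca := bracket_shiftRow_full hv (ν - 1) k
  have hae := bracket_shiftRow_last hv' (ν - 1) k
  have hbe : bracket C (shiftRow v ν (k + 2)) (geomRow a r (k + 1))
      = toeplitzDet v' (ν + 1) (k + 1) := by
    rw [bracket_geomRow]
    simp only [C, cutRow_shiftRow hv']
    unfold toeplitzDet
    congr 1
    ext i j
    refine Fin.cases ?_ (fun i => ?_) i <;> simp [shiftRow] <;> congr 1 <;> ring
  have hbc : bracket C (shiftRow v ν (k + 2)) (shiftRow u (ν - 1) (k + 2))
      = -((-1) ^ k * (s * toeplitzDet u ν (k + 2))) := by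
    rw [bracket_swap, det_cons_snoc_eq]
    congr 2
    -- The `v`-part of this splitting repeats a row already present; the remaining part, `s` times a
    -- row of `u`, heads a row-reduced Toeplitz determinant of `u`.
    have h1 : shiftRow u (ν - 1) (k + 2) = shiftRow v ν (k + 2) + s • shiftRow u ν (k + 2) := by
      ext j
      simp only [shiftRow, hv, Pi.add_apply, Pi.smul_apply, smul_eq_mul]
      have : ν - 1 + ((j : ℕ) : ℤ) = ν + (j : ℕ) - 1 := by ring
      rw [this]
      ring
    let g := ((detRowAlternating (R := K) (n := Fin (k + 2))).curryLeft)
    change g (shiftRow u (ν - 1) (k + 2)) (Fin.cons (shiftRow v ν (k + 2)) C) = _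
    rw [h1, map_add, map_smul, AlternatingMap.add_apply, AlternatingMap.smul_apply, smul_eq_mul]
    have h2 : g (shiftRow v ν (k + 2)) (Fin.cons (shiftRow v ν (k + 2)) C) = 0 :=
      det_zero_of_row_eq (M := of (Fin.cons (shiftRow v ν (k + 2))
        (Fin.cons (shiftRow v ν (k + 2)) C : Fin (k + 1) → Fin (k + 2) → K) :
          Fin (k + 2) → Fin (k + 2) → K)) (i := 0) (j := 1) (by simp) rfl
    rw [h2, zero_add, ← det_cons_shiftRow hv]
    congr 1
    change (of (Fin.cons (shiftRow u ν (k + 2)) (Fin.cons (shiftRow v ν (k + 2)) C :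
      Fin (k + 1) → Fin (k + 2) → K) : Fin (k + 2) → Fin (k + 2) → K)).det = _
    congr 1
    ext i j
    refine Fin.cases ?_ (fun i => Fin.cases ?_ (fun i => ?_) i) i <;>
      simp [C, shiftRow] <;> congr 1 <;> ring
  have h := bracket_plucker C (shiftRow v (ν - 1 - k) (k + 2)) (shiftRow v ν (k + 2))
    (shiftRow u (ν - 1) (k + 2)) (geomRow a r (k + 1))
  rw [hba, hce, hca, hae, hbe, hbc, sub_add_cancel] at h
  have hk : ((-1 : K) ^ k) * (-1) ^ k = 1 := by rw [← mul_pow]; simp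
  linear_combination h - s * toeplitzDet u ν (k + 2) * toeplitzDet v' ν (k + 1) * hk

/-- A bilinear identity relating Toeplitz determinants of sizes `M + 2`, `M + 1` and `M`. -/
theorem toeplitzDet_bilinear_three (hv : ∀ k, v k = u (k - 1) - s * u k)
    (hu' : ∀ k, u' k = a * u (k - 1) - r * u k) (hv' : ∀ k, v' k = a * v (k - 1) - r * v k)
    (ν : ℤ) (M : ℕ) :
    toeplitzDet u' (ν + 1) (M + 1) * toeplitzDet v ν (M + 1)
      - toeplitzDet v' (ν + 1) (M + 1) * toeplitzDet u ν (M + 1)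
      = r * (toeplitzDet u ν (M + 2) * toeplitzDet v' (ν + 1) M) := by
  let C : Fin M → Fin (M + 2) → K := fun i => shiftRow v (ν - (i : ℕ)) (M + 2)
  -- The second geometric row is `geomRow 1 0`, the last unit vector. Its cut drops the last column,
  -- which merely shifts the index by one, so the bracket evaluations also apply with these
  -- parameters.
  have hw : ∀ w : ℤ → K, ∀ k, w (k - 1) = 1 * w (k - 1) - 0 * w k := fun w k => by simp
  have hsh : ∀ (w : ℤ → K) (n : ℕ), toeplitzDet (fun k => w (k - 1)) (ν + 1) n
      = toeplitzDet w ν n := fun w n => by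
    have := toeplitzDet_shift w (ν + 1) (-1) n
    rwa [add_neg_cancel_right] at this
  have hba := bracket_shiftRow_full hv ν M
  have hbe := bracket_shiftRow_head hv hu' hv' ν M
  have hbf := bracket_shiftRow_head hv (hw u) (hw v) ν M
  have hae := bracket_shiftRow_last hv' ν M
  have haf := bracket_shiftRow_last (hw v) ν M
  have hef : bracket C (geomRow a r (M + 1)) (geomRow 1 0 (M + 1))
      = (-1) ^ M * (r * toeplitzDet v' (ν + 1) M) := by
    rw [bracket_geomRow]
    -- Dropping the last entry of a geometric row leaves `r` times a shorter geometric row: this is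
    -- the source of the factor `r`.
    have h1 : cutRow 1 0 (geomRow a r (M + 1)) = r • geomRow a r M := by
      ext j
      have : M + 1 - (j : ℕ) = (M - j) + 1 := by omega
      simp [cutRow, geomRow, this]
      ring
    have h2 := det_snoc_eq (r • geomRow a r M) (fun i => cutRow 1 0 (C i))
    have h3 : (of (Fin.snoc (fun i => cutRow 1 0 (C i)) (r • geomRow a r M) :
        Fin (M + 1) → Fin (M + 1) → K)).det = r * toeplitzDet v' (ν + 1) M := by
      have h4 := (detRowAlternating (R := K) (n := Fin (M + 1))).map_update_smul
        (Fin.snoc (fun i => cutRow 1 0 (C i)) (geomRow a r M)) (Fin.last M) r (geomRow a r M)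
      rw [Fin.update_snoc_last, Fin.update_snoc_last] at h4
      refine h4.trans ?_
      rw [smul_eq_mul]
      congr 1
      refine (det_snoc_geomRow (fun i => cutRow 1 0 (C i)) a r).trans ?_
      simp only [C, cutRow_shiftRow (hw v)]
      unfold toeplitzDet
      congr 1
      ext i j
      simp only [cutRow, shiftRow, of_apply, hv', Fin.val_castSucc, Fin.val_succ, Nat.cast_add,
        Nat.cast_one]
      congr 3 <;> ring
    rw [h1, ← h3, h2, ← mul_assoc, ← mul_pow]
    simp
  have h := bracket_plucker C (shiftRow v (ν - M) (M + 2)) (shiftRow u ν (M + 2))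
    (geomRow a r (M + 1)) (geomRow 1 0 (M + 1))
  rw [hef, bracket_swap C (geomRow a r (M + 1)), hba, hbf, hbe, hae, haf, hsh, hsh] at h
  have hk : ((-1 : K) ^ M) * (-1) ^ M = 1 := by rw [← mul_pow]; simp
  linear_combination (-(-1) ^ M) * h + (toeplitzDet v' (ν + 1) (M + 1) * toeplitzDet u ν (M + 1)
    - toeplitzDet u' (ν + 1) (M + 1) * toeplitzDet v ν (M + 1)
    + r * (toeplitzDet u ν (M + 2) * toeplitzDet v' (ν + 1) M)) * hk

end Telescoping

/-! ### The semiclassical identity. -/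

/-- A bilinear identity for Toeplitz determinants whose symbol is reproduced, up to a geometric
weight, by two successive first order difference operators. -/
theorem toeplitzDet_semiclassical {h v w : ℤ → K} {τ γ r : K} (hr : r ≠ 0)
    (hv : ∀ k, v k = h (k - 1) - h k) (hh : ∀ k, τ * h k = r ^ k * (v (k - 1) - γ * v k))
    (hw : ∀ k, w k = v (k - 1) - r * v k) (ν : ℤ) (M : ℕ) :
    τ * (toeplitzDet h ν (M + 1) * toeplitzDet w (ν + 1) M)
      = r ^ (ν + 1) * (toeplitzDet v (ν + 1) M * toeplitzDet v ν (M + 1))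
        + (τ - γ * r ^ (ν + 1 + M)) * (toeplitzDet v ν M * toeplitzDet v (ν + 1) (M + 1)) := by
  let C : Fin M → Fin (M + 1) → K := fun i => shiftRow v (ν - (i : ℕ)) (M + 1)
  -- The cofactor vector of `C`: pairing a row with `n` puts that row on top of `C` in the
  -- determinant.
  let n : Fin (M + 1) → K := fun j => (-1) ^ (j : ℕ) * (of fun i k => C i (j.succAbove k)).det
  have hl : ∀ x : Fin (M + 1) → K,
      (of (Fin.cons x C : Fin (M + 1) → Fin (M + 1) → K)).det = ∑ j, x j * n j := by
    intro x
    rw [det_succ_row_zero]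
    refine Finset.sum_congr rfl fun j _ => ?_
    have : (of (Fin.cons x C : Fin (M + 1) → Fin (M + 1) → K)).submatrix Fin.succ j.succAbove
        = of fun i k => C i (j.succAbove k) := by
      ext i k; simp
    rw [this]
    simp only [of_apply, Fin.cons_zero, n]
    ring
  let ξ : ℤ → K := fun k => ∑ j : Fin (M + 1), v (k + (j : ℕ)) * n j
  let ζ : ℤ → K := fun k => ∑ j : Fin (M + 1), h (k + (j : ℕ)) * n j
  have hξ : ∀ k, ξ k = (of (Fin.cons (shiftRow v k (M + 1)) C :
      Fin (M + 1) → Fin (M + 1) → K)).det := fun k => (hl _).symm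
  have hξ0 : ∀ i : Fin M, ξ (ν - (i : ℕ)) = 0 := by
    intro i
    rw [hξ]
    refine det_zero_of_row_eq (i := 0) (j := i.succ) (Fin.succ_ne_zero _).symm ?_
    ext j
    simp [C]
  have hζξ : ∀ k, ξ k = ζ (k - 1) - ζ k := by
    intro k
    simp only [ξ, ζ, ← Finset.sum_sub_distrib, hv]
    refine Finset.sum_congr rfl fun j _ => ?_
    rw [← sub_mul]
    congr 3
    ring
  -- Since `ξ` is the difference of `ζ` and vanishes at `ν, …, ν - M + 1`, `ζ` is constant from `ν -
  -- M` to `ν`.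
  have hζ : ∀ i : ℕ, i ≤ M → ζ (ν - i) = ζ ν := by
    intro i
    induction i with
    | zero => simp
    | succ i ih =>
      intro hi
      have h1 := hζξ (ν - i)
      rw [hξ0 ⟨i, hi⟩, ih (by omega)] at h1
      have : ν - ((i + 1 : ℕ) : ℤ) = ν - i - 1 := by push_cast; ring
      rw [this]
      exact sub_eq_zero.mp h1.symm
  have hζν : ζ ν = toeplitzDet h ν (M + 1) := by
    rw [← det_cons_shiftRow (s := 1) (v := v) (fun k => by rw [hv, one_mul]), hl]
    rfl
  have hσ : ξ (ν + 1) = toeplitzDet v (ν + 1) (M + 1) := by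
    rw [hξ]
    unfold toeplitzDet
    congr 1
    ext i j
    refine Fin.cases ?_ (fun i => ?_) i
    · simp [shiftRow]
    · simp [C, shiftRow]
  have hξM : ξ (ν - M) = (-1) ^ M * toeplitzDet v ν (M + 1) := by
    rw [hξ]
    have h1 := det_snoc_eq (shiftRow v (ν - M) (M + 1)) C
    have h2 : (of (Fin.snoc C (shiftRow v (ν - M) (M + 1)) :
        Fin (M + 1) → Fin (M + 1) → K)).det = toeplitzDet v ν (M + 1) := by
      unfold toeplitzDet
      congr 1
      ext i j
      refine Fin.lastCases ?_ (fun i => ?_) i <;> simp [C, shiftRow]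
    rw [← h2, h1, ← mul_assoc, ← mul_pow]
    simp
  have hn0 : n 0 = toeplitzDet v (ν + 1) M := by
    simp only [n, Fin.val_zero, pow_zero, one_mul]
    unfold toeplitzDet
    congr 1
    ext i j
    simp only [C, shiftRow, of_apply, Fin.succAbove_zero, Fin.val_succ]
    congr 1
    push_cast
    ring
  have hnM : n (Fin.last M) = (-1) ^ M * toeplitzDet v ν M := by
    simp only [n, Fin.val_last]
    unfold toeplitzDet
    congr 2
    ext i j
    simp [C, shiftRow]
  have he : ∑ i : Fin (M + 1), r ^ (M - (i : ℕ)) * n i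
      = (-1) ^ M * toeplitzDet w (ν + 1) M := by
    have h1 := det_snoc_eq (geomRow 1 r M) C
    have h2 : (of (Fin.snoc C (geomRow 1 r M) : Fin (M + 1) → Fin (M + 1) → K)).det
        = toeplitzDet w (ν + 1) M := by
      rw [det_snoc_geomRow]
      have hw' : ∀ k, w k = 1 * v (k - 1) - r * v k := fun k => by rw [hw, one_mul]
      simp only [C, cutRow_shiftRow hw']
      unfold toeplitzDet
      congr 1
      ext i j
      simp only [shiftRow, of_apply]
      congr 1
      ring
    rw [← h2, h1, hl, ← mul_assoc, ← mul_pow]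
    simp [geomRow]
  -- A double sum over `n i * n j`. Summed over `j` first, it meets the constant range of `ζ` except
  -- at `i = M`. Summed over `i` first, the relation `hh` turns it into values of `ξ`, almost all
  -- zero.
  let S : K := ∑ i : Fin (M + 1), r ^ (M - (i : ℕ)) * n i * ζ (ν - M + 1 + (i : ℕ))
  have hS1 : S = ζ ν * ((-1) ^ M * toeplitzDet w (ν + 1) M)
      - n (Fin.last M) * ξ (ν + 1) := by
    have hlast : ζ (ν - M + 1 + ((Fin.last M : Fin (M + 1)) : ℕ)) = ζ ν - ξ (ν + 1) := by
      rw [hζξ, add_sub_cancel_right, Fin.val_last]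
      have : ν - (M : ℤ) + 1 + M = ν + 1 := by ring
      rw [this]
      ring
    rw [← he]
    simp only [S]
    rw [Fin.sum_univ_castSucc, Fin.sum_univ_castSucc (f := fun i => r ^ (M - (i : ℕ)) * n i),
      hlast, mul_add, Finset.mul_sum]
    have : ∀ i : Fin M, r ^ (M - (i.castSucc : ℕ)) * n i.castSucc
        * ζ (ν - M + 1 + (i.castSucc : ℕ)) = ζ ν * (r ^ (M - (i.castSucc : ℕ)) * n i.castSucc) := by
      intro i
      have h1 : ν - (M : ℤ) + 1 + (i.castSucc : ℕ) = ν - ((M - 1 - i : ℕ) : ℤ) := by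
        have := i.2
        simp only [Fin.val_castSucc]
        omega
      rw [h1, hζ _ (by omega)]
      ring
    rw [Finset.sum_congr rfl fun i _ => this i]
    simp only [Fin.val_last, Nat.sub_self, pow_zero, one_mul]
    ring
  have hS2 : τ * S = r ^ (ν + 1) * (n 0 * ξ (ν - M))
      - γ * r ^ (ν + 1 + M) * (n (Fin.last M) * ξ (ν + 1)) := by
    have h1 : τ * S = ∑ j : Fin (M + 1), n j * r ^ (ν + 1 + (j : ℕ))
        * (ξ (ν - M + (j : ℕ)) - γ * ξ (ν - M + 1 + (j : ℕ))) := by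
      simp only [S, ζ, ξ, Finset.mul_sum, ← Finset.sum_sub_distrib]
      rw [Finset.sum_comm]
      refine Finset.sum_congr rfl fun j _ => Finset.sum_congr rfl fun i _ => ?_
      have h2 := hh (ν - M + 1 + (i : ℕ) + (j : ℕ))
      -- The weight in `S` is chosen so that, with the power of `r` from `hh`, the dependence on `i`
      -- cancels.
      have h3 : r ^ (M - (i : ℕ)) * r ^ (ν - M + 1 + (i : ℕ) + (j : ℕ) : ℤ)
          = r ^ (ν + 1 + (j : ℕ)) := by
        rw [← zpow_natCast, ← zpow_add₀ hr]
        congr 1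
        have := i.2
        omega
      have h4 : ν - (M : ℤ) + 1 + (i : ℕ) + (j : ℕ) - 1 = ν - M + (j : ℕ) + (i : ℕ) := by ring
      have h5 : ν - (M : ℤ) + 1 + (i : ℕ) + (j : ℕ) = ν - M + 1 + (j : ℕ) + (i : ℕ) := by ring
      rw [h4] at h2
      rw [← h3]
      rw [h5] at h2 ⊢
      linear_combination r ^ (M - (i : ℕ)) * n i * n j * h2
    rw [h1]
    simp only [mul_sub, Finset.sum_sub_distrib]
    congr 1
    · rw [Fin.sum_univ_succ, Finset.sum_eq_zero]
      · simp
        ring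
      · intro j _
        have : ν - (M : ℤ) + (j.succ : ℕ) = ν - ((M - 1 - j : ℕ) : ℤ) := by
          have := j.2
          simp only [Fin.val_succ]
          omega
        rw [this, hξ0 ⟨M - 1 - j, by omega⟩, mul_zero]
    · rw [Fin.sum_univ_castSucc, Finset.sum_eq_zero]
      · simp
        have : ν - (M : ℤ) + 1 + M = ν + 1 := by ring
        rw [this]
        ring
      · intro j _
        have : ν - (M : ℤ) + 1 + (j.castSucc : ℕ) = ν - ((M - 1 - j : ℕ) : ℤ) := by
          have := j.2
          simp only [Fin.val_castSucc]
          omega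
        rw [this, hξ0 ⟨M - 1 - j, by omega⟩, mul_zero, mul_zero]
  rw [hS1, hn0, hnM, hξM, hσ, hζν] at hS2
  have hk : ((-1 : K) ^ M) * (-1) ^ M = 1 := by rw [← mul_pow]; simp
  linear_combination (-1) ^ M * hS2 + (r ^ (ν + 1) * (toeplitzDet v (ν + 1) M *
    toeplitzDet v ν (M + 1)) + (τ - γ * r ^ (ν + 1 + M)) * (toeplitzDet v ν M *
    toeplitzDet v (ν + 1) (M + 1)) - τ * (toeplitzDet h ν (M + 1) * toeplitzDet w (ν + 1) M)) * hk

/-! ### Identities for contiguous sequences. -/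

section Contiguous

variable {x y z : ℤ → K} {p α d : K}

theorem toeplitzDet_zpow_mul_succ (u : ℤ → K) {p : K} (hp : p ≠ 0) (ν : ℤ) (M : ℕ) :
    toeplitzDet (fun k => p ^ k * u k) ν (M + 1)
      = p ^ (ν * M) * p ^ ν * toeplitzDet u ν (M + 1) := by
  rw [toeplitzDet_zpow_mul u hp, ← zpow_add₀ hp]
  congr 2
  push_cast
  ring

theorem toeplitzDet_zpow_mul_pred_succ (u : ℤ → K) {p : K} (hp : p ≠ 0) (ν : ℤ) (M : ℕ) :
    p ^ (M + 1) * toeplitzDet (fun k => p ^ k * u k) (ν - 1) (M + 1)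
      = p ^ (ν * M) * p ^ ν * toeplitzDet u (ν - 1) (M + 1) := by
  rw [toeplitzDet_zpow_mul u hp, ← mul_assoc, ← zpow_natCast, ← zpow_add₀ hp, ← zpow_add₀ hp]
  congr 2
  push_cast
  ring

theorem toeplitzDet_zpow_mul_succ_index (u : ℤ → K) {p : K} (hp : p ≠ 0) (ν : ℤ) (M : ℕ) :
    toeplitzDet (fun k => p ^ k * u k) (ν + 1) M
      = p ^ (ν * M) * p ^ M * toeplitzDet u (ν + 1) M := by
  rw [toeplitzDet_zpow_mul u hp, ← zpow_natCast p M, ← zpow_add₀ hp]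
  congr 2
  ring

theorem weighted_difference (hp : p ≠ 0)
    (h1 : ∀ k, α * d * y k = p ^ k * (p⁻¹ * x (k - 1) - x k)) (k : ℤ) :
    α * d * y k = p ^ (k - 1) * x (k - 1) - 1 * (p ^ k * x k) := by
  rw [h1, zpow_sub_one₀ hp]
  ring

theorem weighted_cut (hp : p ≠ 0) (h2z : ∀ k, z k = x (k - 1) - p * d * x k) (k : ℤ) :
    p⁻¹ * (p ^ k * z k) = 1 * (p ^ (k - 1) * x (k - 1)) - d * (p ^ k * x k) := by
  rw [h2z, zpow_sub_one₀ hp]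
  field_simp

theorem const_cut (h2 : ∀ k, x k = y (k - 1) - d * y k) (t : K) (k : ℤ) :
    t * x k = 1 * (t * y (k - 1)) - d * (t * y k) := by
  rw [h2]
  ring

/-- With `a = 0`, `r = -1` the cut drops the first column and leaves the sequences unchanged. -/
theorem toeplitzDet_contiguous (hp : p ≠ 0) (hα : α ≠ 0) (hd : d ≠ 0)
    (h1 : ∀ k, α * d * y k = p ^ k * (p⁻¹ * x (k - 1) - x k)) (ν : ℤ) (M : ℕ) :
    α * d * (p ^ ν)⁻¹ * toeplitzDet y ν (M + 1) * toeplitzDet x ν M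
      + toeplitzDet x ν (M + 1) * toeplitzDet y ν M
      = (p ^ (M + 1))⁻¹ * toeplitzDet y (ν + 1) M * toeplitzDet x (ν - 1) (M + 1) := by
  have h := toeplitzDet_bilinear (u := fun k => p ^ k * x k) (v := fun k => α * d * y k)
    (u' := fun k => p ^ k * x k) (v' := fun k => α * d * y k) (a := 0) (r := -1)
    (weighted_difference hp h1) (fun k => by ring) (fun k => by ring) ν M
  have h3 := toeplitzDet_zpow_mul_pred_succ x hp ν M
  simp only [toeplitzDet_const_mul, toeplitzDet_zpow_mul_succ x hp ν M,
    toeplitzDet_zpow_mul x hp ν M] at h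
  have hw : p ^ ν ≠ 0 := zpow_ne_zero _ hp
  have hE : p ^ (ν * M) ≠ 0 := zpow_ne_zero _ hp
  have ht : (α * d) ^ M ≠ 0 := pow_ne_zero _ (mul_ne_zero hα hd)
  have hπ : p ^ (M + 1) ≠ 0 := pow_ne_zero _ hp
  refine mul_left_cancel₀ (mul_ne_zero (mul_ne_zero (mul_ne_zero ht hE) hw) hπ) ?_
  have e1 := mul_inv_cancel₀ hw
  have e2 := mul_inv_cancel₀ hπ
  rw [pow_succ (α * d) M] at h
  generalize toeplitzDet (fun k => p ^ k * x k) (ν - 1) (M + 1) = A at *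
  generalize (p ^ ν)⁻¹ = wi at *
  generalize (p ^ (M + 1))⁻¹ = πi at *
  linear_combination p ^ (M + 1) * h + (α * d) ^ M * toeplitzDet y (ν + 1) M * h3
    + (α * d) ^ M * p ^ (ν * M) * p ^ (M + 1) * α * d * toeplitzDet y ν (M + 1)
      * toeplitzDet x ν M * e1
    - (α * d) ^ M * p ^ (ν * M) * p ^ ν * toeplitzDet y (ν + 1) M
      * toeplitzDet x (ν - 1) (M + 1) * e2

/-- The cut `a = 1`, `r = 0` drops the last column instead; the resulting shift is what
distinguishes this from `toeplitzDet_contiguous`. -/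
theorem toeplitzDet_contiguous_succ (hp : p ≠ 0) (hα : α ≠ 0) (hd : d ≠ 0)
    (h1 : ∀ k, α * d * y k = p ^ k * (p⁻¹ * x (k - 1) - x k)) (ν : ℤ) (M : ℕ) :
    α * d * (p ^ ν)⁻¹ * toeplitzDet y (ν + 1) (M + 1) * toeplitzDet x ν M
      + p ^ (M + 1) * toeplitzDet x (ν + 1) (M + 1) * toeplitzDet y ν M
      = toeplitzDet y (ν + 1) M * toeplitzDet x ν (M + 1) := by
  have h := toeplitzDet_bilinear (u := fun k => p ^ k * x k) (v := fun k => α * d * y k)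
    (u' := fun k => p ^ (k + -1) * x (k + -1)) (v' := fun k => α * d * y (k + -1)) (a := 1) (r := 0)
    (weighted_difference hp h1) (fun k => by simp [sub_eq_add_neg])
    (fun k => by simp [sub_eq_add_neg]) (ν + 1) M
  have h3 := toeplitzDet_shift (fun k => p ^ k * x k) (ν + 1) (-1) M
  have h4 := toeplitzDet_shift y (ν + 1) (-1) M
  have h5 := toeplitzDet_shift y (ν + 1 + 1) (-1) M
  have h6 := toeplitzDet_zpow_mul_pred_succ x hp (ν + 1) M
  rw [h3, toeplitzDet_const_mul, toeplitzDet_const_mul _ (α * d), h4,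
    toeplitzDet_const_mul _ (α * d), h5] at h
  simp only [add_neg_cancel_right, add_sub_cancel_right, toeplitzDet_zpow_mul_succ x hp,
    toeplitzDet_zpow_mul x hp ν M] at h
  have hw : p ^ ν ≠ 0 := zpow_ne_zero _ hp
  have hE : p ^ (ν * M) ≠ 0 := zpow_ne_zero _ hp
  have ht : (α * d) ^ M ≠ 0 := pow_ne_zero _ (mul_ne_zero hα hd)
  refine mul_left_cancel₀ (mul_ne_zero (mul_ne_zero ht hE) hw) ?_
  have e1 := mul_inv_cancel₀ hw
  have e3 : p ^ ((ν + 1) * M) * p ^ (ν + 1) = p ^ (ν * M) * p ^ ν * p ^ (M + 1) := by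
    rw [← zpow_natCast p (M + 1), ← zpow_add₀ hp, ← zpow_add₀ hp, ← zpow_add₀ hp]
    congr 1
    push_cast
    ring
  rw [pow_succ (α * d) M, e3] at h
  generalize (p ^ ν)⁻¹ = wi at *
  linear_combination h + (α * d) ^ M * p ^ (ν * M) * α * d * toeplitzDet y (ν + 1) (M + 1)
      * toeplitzDet x ν M * e1

theorem toeplitzDet_difference (h2 : ∀ k, x k = y (k - 1) - d * y k) (ν : ℤ) (M : ℕ) :
    toeplitzDet x (ν + 1) (M + 1) * toeplitzDet y ν M
      + d * (toeplitzDet y (ν + 1) (M + 1) * toeplitzDet x ν M)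
      = toeplitzDet y ν (M + 1) * toeplitzDet x (ν + 1) M := by
  have h := toeplitzDet_bilinear (u := y) (v := x)
    (u' := fun k => y (k + -1)) (v' := fun k => x (k + -1)) (a := 1) (r := 0)
    h2 (fun k => by simp [sub_eq_add_neg]) (fun k => by simp [sub_eq_add_neg]) (ν + 1) M
  simpa only [toeplitzDet_shift, add_neg_cancel_right, add_sub_cancel_right] using h

theorem toeplitzDet_difference_three (h2 : ∀ k, x k = y (k - 1) - d * y k) (ν : ℤ) (M : ℕ) :
    toeplitzDet y (ν + 1) (M + 1) * toeplitzDet x ν (M + 1)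
      - toeplitzDet x (ν + 1) (M + 1) * toeplitzDet y ν (M + 1)
      = -(toeplitzDet y ν (M + 2) * toeplitzDet x (ν + 1) M) := by
  have h := toeplitzDet_bilinear_three (u := y) (v := x)
    (u' := y) (v' := x) (a := 0) (r := -1) h2 (fun k => by ring) (fun k => by ring) ν M
  rw [h]
  ring

theorem toeplitzDet_contiguous_three (hp : p ≠ 0) (hα : α ≠ 0) (hd : d ≠ 0)
    (h1 : ∀ k, α * d * y k = p ^ k * (p⁻¹ * x (k - 1) - x k)) (ν : ℤ) (M : ℕ) :
    toeplitzDet y (ν + 1) (M + 1) * toeplitzDet x ν (M + 1)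
      - p ^ (M + 1) * toeplitzDet x (ν + 1) (M + 1) * toeplitzDet y ν (M + 1)
      = p ^ ν / (α * d) * toeplitzDet y (ν + 1) M * toeplitzDet x ν (M + 2) := by
  have h := toeplitzDet_bilinear_three (u := fun k => p ^ k * x k) (v := fun k => α * d * y k)
    (u' := fun k => p ^ k * x k) (v' := fun k => α * d * y k) (a := 0) (r := -1)
    (weighted_difference hp h1) (fun k => by ring) (fun k => by ring) ν M
  have e := toeplitzDet_zpow_mul_succ x hp ν (M + 1)
  simp only [toeplitzDet_const_mul, toeplitzDet_zpow_mul_succ_index x hp ν (M + 1),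
    toeplitzDet_zpow_mul x hp ν (M + 1)] at h
  rw [e, pow_succ (α * d)] at h
  have hE : p ^ (ν * (M + 1 : ℕ)) ≠ 0 := zpow_ne_zero _ hp
  have ht : (α * d) ^ M ≠ 0 := pow_ne_zero _ (mul_ne_zero hα hd)
  have hαd : α * d ≠ 0 := mul_ne_zero hα hd
  have e1 : p ^ ν / (α * d) * (α * d) = p ^ ν := div_mul_cancel₀ _ hαd
  refine mul_left_cancel₀ (mul_ne_zero (mul_ne_zero ht hE) hαd) ?_
  generalize p ^ ν / (α * d) = κ at *
  linear_combination -h - (α * d) ^ M * p ^ (ν * (M + 1 : ℕ)) * toeplitzDet y (ν + 1) M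
    * toeplitzDet x ν (M + 2) * e1

/-- The cut `a = 1`, `r = d` serves both sequences at once: it sends `y` to `x`, and the weighted
`x` to the weighted `z` up to `p⁻¹`. -/
theorem toeplitzDet_contiguous_cut (hp : p ≠ 0) (hα : α ≠ 0) (hd : d ≠ 0)
    (h1 : ∀ k, α * d * y k = p ^ k * (p⁻¹ * x (k - 1) - x k))
    (h2 : ∀ k, x k = y (k - 1) - d * y k)
    (h2z : ∀ k, z k = x (k - 1) - p * d * x k) (ν : ℤ) (M : ℕ) :
    p ^ (M + 1) * toeplitzDet x ν (M + 1) * toeplitzDet x ν M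
      - toeplitzDet x (ν + 1) M * toeplitzDet x (ν - 1) (M + 1)
      = -(α * d * (p * (p ^ ν)⁻¹) * toeplitzDet z ν M * toeplitzDet y ν (M + 1)) := by
  have h := toeplitzDet_bilinear (u := fun k => p ^ k * x k) (v := fun k => α * d * y k)
    (u' := fun k => p⁻¹ * (p ^ k * z k)) (v' := fun k => α * d * x k) (a := 1) (r := d)
    (weighted_difference hp h1) (weighted_cut hp h2z) (const_cut h2 _) ν M
  have h3 := toeplitzDet_zpow_mul_pred_succ x hp ν M
  rw [toeplitzDet_const_mul _ p⁻¹, toeplitzDet_zpow_mul z hp ν M] at h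
  simp only [toeplitzDet_const_mul, toeplitzDet_zpow_mul_succ x hp ν M] at h
  have hw : p ^ ν ≠ 0 := zpow_ne_zero _ hp
  have hE : p ^ (ν * M) ≠ 0 := zpow_ne_zero _ hp
  have ht : (α * d) ^ M ≠ 0 := pow_ne_zero _ (mul_ne_zero hα hd)
  have e1 := mul_inv_cancel₀ hw
  have e2 : p ^ (M + 1) * p⁻¹ ^ M = p := by
    rw [pow_succ, inv_pow]
    field_simp
  refine mul_left_cancel₀ (mul_ne_zero (mul_ne_zero ht hE) hw) ?_
  rw [pow_succ (α * d) M] at h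
  generalize toeplitzDet (fun k => p ^ k * x k) (ν - 1) (M + 1) = A at *
  generalize (p ^ ν)⁻¹ = wi at *
  generalize (p⁻¹) ^ M = πi at *
  linear_combination p ^ (M + 1) * h + (α * d) ^ M * toeplitzDet x (ν + 1) M * h3
    + (α * d) ^ M * p ^ (ν * M) * α * d * toeplitzDet y ν (M + 1) * toeplitzDet z ν M
      * (p * e1 - e2)

theorem toeplitzDet_contiguous_cut_three (hp : p ≠ 0) (hα : α ≠ 0) (hd : d ≠ 0)
    (h1 : ∀ k, α * d * y k = p ^ k * (p⁻¹ * x (k - 1) - x k))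
    (h2 : ∀ k, x k = y (k - 1) - d * y k)
    (h2z : ∀ k, z k = x (k - 1) - p * d * x k) (ν : ℤ) (M : ℕ) :
    α * (p ^ ν)⁻¹ * toeplitzDet x ν (M + 1) * toeplitzDet x (ν + 1) (M + 1)
      + toeplitzDet x (ν + 1) M * toeplitzDet x ν (M + 2)
      = α * (p ^ ν)⁻¹ * toeplitzDet z (ν + 1) (M + 1) * toeplitzDet y ν (M + 1) := by
  have h := toeplitzDet_bilinear_three (u := fun k => p ^ k * x k) (v := fun k => α * d * y k)
    (u' := fun k => p⁻¹ * (p ^ k * z k)) (v' := fun k => α * d * x k) (a := 1) (r := d)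
    (weighted_difference hp h1) (weighted_cut hp h2z) (const_cut h2 _) ν M
  have e := toeplitzDet_zpow_mul_succ x hp ν (M + 1)
  rw [toeplitzDet_const_mul _ p⁻¹, toeplitzDet_zpow_mul_succ_index z hp ν (M + 1), e,
    toeplitzDet_zpow_mul x hp ν (M + 1)] at h
  simp only [toeplitzDet_const_mul] at h
  rw [pow_succ (α * d)] at h
  have hw : p ^ ν ≠ 0 := zpow_ne_zero _ hp
  have hE : p ^ (ν * (M + 1 : ℕ)) ≠ 0 := zpow_ne_zero _ hp
  have ht : (α * d) ^ M ≠ 0 := pow_ne_zero _ (mul_ne_zero hα hd)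
  have e2 : p⁻¹ ^ (M + 1) * p ^ (M + 1) = 1 := by
    rw [← mul_pow, inv_mul_cancel₀ hp, one_pow]
  have e1 := mul_inv_cancel₀ hw
  refine mul_left_cancel₀ (mul_ne_zero (mul_ne_zero (mul_ne_zero ht hE) hw) hd) ?_
  generalize (p ^ ν)⁻¹ = wi at *
  generalize (p⁻¹) ^ (M + 1) = πi at *
  linear_combination -h + (α * d) ^ M * p ^ (ν * (M + 1 : ℕ)) * d * α *
    (toeplitzDet x ν (M + 1) * toeplitzDet x (ν + 1) (M + 1)
      - toeplitzDet z (ν + 1) (M + 1) * toeplitzDet y ν (M + 1)) * e1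
    + (α * d) ^ M * p ^ (ν * (M + 1 : ℕ)) * α * d * toeplitzDet z (ν + 1) (M + 1)
      * toeplitzDet y ν (M + 1) * e2

/-- In the semiclassical identity take `h`, `v`, `w` to be `z`, `x`, `y` suitably weighted, with `r
= p` and `γ = p * d`. Its three hypotheses are then `h1z`, `h2z` and `h1`. -/
theorem toeplitzDet_contiguous_semiclassical (hp : p ≠ 0) (hα : α ≠ 0) (hd : d ≠ 0)
    (h1 : ∀ k, α * d * y k = p ^ k * (p⁻¹ * x (k - 1) - x k))
    (h1z : ∀ k, α * (p * d) * x k = p ^ k * (p⁻¹ * z (k - 1) - z k))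
    (h2z : ∀ k, z k = x (k - 1) - p * d * x k) (ν : ℤ) (M : ℕ) :
    toeplitzDet x ν (M + 1) * toeplitzDet x (ν + 1) M
      + d * (α * (p ^ ν)⁻¹ - p ^ (M + 1)) * toeplitzDet x ν M * toeplitzDet x (ν + 1) (M + 1)
      = (p ^ (M + 1))⁻¹ * toeplitzDet z ν (M + 1) * toeplitzDet y (ν + 1) M := by
  let τ : K := α * (p * d)
  have hw : p ^ ν ≠ 0 := zpow_ne_zero _ hp
  have hτ : τ ≠ 0 := mul_ne_zero hα (mul_ne_zero hp hd)
  have hv : ∀ k, τ * x k = p ^ (k - 1) * z (k - 1) - p ^ k * z k := fun k => by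
    rw [weighted_difference (d := p * d) hp h1z, one_mul]
  have hy : ∀ k, τ * τ * ((p⁻¹) ^ k * y k) = τ * x (k - 1) - p * (τ * x k) := fun k => by
    have hk : p ^ k ≠ 0 := zpow_ne_zero _ hp
    have e := mul_inv_cancel₀ hk
    have e2 := mul_inv_cancel₀ hp
    rw [_root_.inv_zpow]
    simp only [τ]
    linear_combination α * (p * d) * p * (p ^ k)⁻¹ * h1 k
      + α * (p * d) * (x (k - 1) * p * p⁻¹ - p * x k) * e + α * (p * d) * x (k - 1) * e2
  have h := toeplitzDet_semiclassical (h := fun k => p ^ k * z k) (v := fun k => τ * x k)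
    (w := fun k => τ * τ * ((p⁻¹) ^ k * y k)) (τ := τ) (γ := p * d) hp hv
    (fun k => by rw [h2z]; ring) hy ν M
  rw [toeplitzDet_zpow_mul_succ z hp, toeplitzDet_const_mul _ (τ * τ),
    toeplitzDet_zpow_mul_succ_index y (inv_ne_zero hp)] at h
  simp only [toeplitzDet_const_mul] at h
  have e1 : p ^ (ν * M) * p⁻¹ ^ (ν * M) = 1 := by
    rw [← _root_.mul_zpow, mul_inv_cancel₀ hp, _root_.one_zpow]
  have e2 : p ^ (ν + 1 + M) = p ^ ν * p ^ (M + 1) := by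
    rw [← zpow_natCast p (M + 1), ← zpow_add₀ hp]
    congr 1
    push_cast
    ring
  have e3 : p ^ (ν + 1) = p ^ ν * p := zpow_add_one₀ hp ν
  have e4 : p⁻¹ ^ M = p * (p ^ (M + 1))⁻¹ := by
    rw [pow_succ, inv_pow]
    field_simp
  have e5 := mul_inv_cancel₀ hw
  rw [e2, e3, e4] at h
  have ht : τ * (τ ^ M * τ ^ M) ≠ 0 := mul_ne_zero hτ (mul_ne_zero (pow_ne_zero _ hτ)
    (pow_ne_zero _ hτ))
  refine mul_left_cancel₀ (mul_ne_zero (mul_ne_zero ht hw) hp) ?_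
  rw [mul_pow, pow_succ τ M] at h
  have hτ' : α * d * p = τ := by simp only [τ]; ring
  generalize (p ^ ν)⁻¹ = wi at *
  generalize (p ^ (M + 1))⁻¹ = πi at *
  linear_combination -h + τ * (τ ^ M * τ ^ M) * p ^ ν * p * πi * toeplitzDet z ν (M + 1)
      * toeplitzDet y (ν + 1) M * e1
    + τ * (τ ^ M * τ ^ M) * toeplitzDet x ν M * toeplitzDet x (ν + 1) (M + 1)
      * (p ^ ν * wi * hτ' + τ * e5)

end Contiguous

/-! ### The bilinear equations for `phi`. -/

theorem phi_neg_natCast (G : ℤ → ℂ → ℂ) (M : ℕ) (ν : ℤ) (c : ℂ) :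
    phi G (-M) ν c = toeplitzDet (fun k => G k c) ν M := by
  change toeplitzDet (fun k => G k c) ν (-(-(M : ℤ))).toNat = _
  rw [neg_neg, Int.toNat_natCast]

theorem zpow_two_mul_eq (q : ℂ) (k : ℤ) : q ^ (2 * k) = (((q ^ 2)⁻¹) ^ k)⁻¹ := by
  rw [_root_.zpow_mul, _root_.inv_zpow, inv_inv]
  rfl

section

variable {q a₀ : ℂ} {D : Set ℂ} {G : ℤ → ℂ → ℂ}

theorem ContiguityRelations.weighted (hG : ContiguityRelations q a₀ D G) (hq : q ≠ 0) {c : ℂ}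
    (hc : c ∈ D) (k : ℤ) :
    a₀ ^ 2 * c ^ 2 * G k (q * c)
      = ((q ^ 2)⁻¹) ^ k * (((q ^ 2)⁻¹)⁻¹ * G (k - 1) c - G k c) := by
  have h := hG.cn1 k c hc
  have hw : ((q ^ 2)⁻¹) ^ k ≠ 0 := zpow_ne_zero _ (inv_ne_zero (pow_ne_zero _ hq))
  have e := mul_inv_cancel₀ hw
  rw [zpow_two_mul_eq] at h
  rw [inv_inv]
  linear_combination ((q ^ 2)⁻¹) ^ k * h - a₀ ^ 2 * c ^ 2 * G k (q * c) * e

theorem ContiguityRelations.difference (hG : ContiguityRelations q a₀ D G) {c : ℂ}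
    (hc : c ∈ D) (k : ℤ) : G k c = G (k - 1) (q * c) - c ^ 2 * G k (q * c) := by
  have h := hG.cn2 (k - 1) c hc
  rw [sub_add_cancel] at h
  rw [h]
  ring

theorem bilinearEquations_phi (hq : q ≠ 0) (ha₀ : a₀ ≠ 0) (hD0 : (0 : ℂ) ∉ D)
    (hD : ∀ c ∈ D, q⁻¹ * c ∈ D) (hG : ContiguityRelations q a₀ D G) {N : ℤ} (hN : N < 0)
    (ν : ℤ) {c : ℂ} (hc : c ∈ D) : BilinearEquations q a₀ (phi G) N ν c := by
  -- With this `M`, the indices `N + 1`, `N`, `N - 1` correspond to sizes `M`, `M + 1`, `M + 2`.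
  obtain ⟨M, rfl⟩ : ∃ M : ℕ, N = -((M + 1 : ℕ) : ℤ) := ⟨(-N).toNat - 1, by omega⟩
  have hN1 : -((M + 1 : ℕ) : ℤ) + 1 = -(M : ℤ) := by push_cast; ring
  have hN2 : -((M + 1 : ℕ) : ℤ) - 1 = -((M + 2 : ℕ) : ℤ) := by push_cast; ring
  have hc0 : c ≠ 0 := fun h => hD0 (h ▸ hc)
  have hp : (q ^ 2)⁻¹ ≠ 0 := inv_ne_zero (pow_ne_zero _ hq)
  have hα : a₀ ^ 2 ≠ 0 := pow_ne_zero _ ha₀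
  have hd : c ^ 2 ≠ 0 := pow_ne_zero _ hc0
  have hqc : q * (q⁻¹ * c) = c := mul_inv_cancel_left₀ hq c
  have hpd : (q⁻¹ * c) ^ 2 = (q ^ 2)⁻¹ * c ^ 2 := by rw [mul_pow, inv_pow]
  have h1 := hG.weighted hq hc
  have h2 := hG.difference hc
  have h1z := hG.weighted hq (hD c hc)
  have h2z := hG.difference (hD c hc)
  rw [hqc, hpd] at h1z h2z
  have e1 : q ^ (2 * ν) = (((q ^ 2)⁻¹) ^ ν)⁻¹ := zpow_two_mul_eq q ν
  have e2 : q ^ (2 * -((M + 1 : ℕ) : ℤ)) = ((q ^ 2)⁻¹) ^ (M + 1) := by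
    rw [zpow_two_mul_eq, _root_.zpow_neg, inv_inv, zpow_natCast]
  have e3 : q ^ (-2 * -((M + 1 : ℕ) : ℤ)) = (((q ^ 2)⁻¹) ^ (M + 1))⁻¹ := by
    rw [neg_mul, _root_.zpow_neg, e2]
  have e4 : q ^ (2 * (ν - 1)) = (q ^ 2)⁻¹ * (((q ^ 2)⁻¹) ^ ν)⁻¹ := by
    rw [zpow_two_mul_eq, zpow_sub_one₀ hp, mul_inv, inv_inv, mul_comm]
  have hw : ((q ^ 2)⁻¹) ^ ν ≠ 0 := zpow_ne_zero _ hp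
  have hs := toeplitzDet_contiguous_succ (x := fun k => G k c) (y := fun k => G k (q * c))
    hp hα hd h1 ν M
  have hdiff := toeplitzDet_difference (x := fun k => G k c) (y := fun k => G k (q * c))
    h2 ν M
  have hbl1 := toeplitzDet_contiguous (x := fun k => G k c) (y := fun k => G k (q * c))
    hp hα hd h1 ν M
  have hbl3 := toeplitzDet_difference_three (x := fun k => G k c) (y := fun k => G k (q * c))
    h2 ν M
  have hbl3a := toeplitzDet_contiguous_three (x := fun k => G k c) (y := fun k => G k (q * c))
    hp hα hd h1 ν M
  have hbl4 := toeplitzDet_contiguous_cut (x := fun k => G k c) (y := fun k => G k (q * c))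
    (z := fun k => G k (q⁻¹ * c)) hp hα hd h1 h2 h2z ν M
  have hbl5 := toeplitzDet_contiguous_semiclassical (x := fun k => G k c) (y := fun k => G k (q * c))
    (z := fun k => G k (q⁻¹ * c)) hp hα hd h1 h1z h2z ν M
  have hbl6 := toeplitzDet_contiguous_cut_three (x := fun k => G k c) (y := fun k => G k (q * c))
    (z := fun k => G k (q⁻¹ * c)) hp hα hd h1 h2 h2z ν M
  have hden : 1 / (a₀ ^ 2 * q ^ (2 * ν) * c ^ 2) = ((q ^ 2)⁻¹) ^ ν / (a₀ ^ 2 * c ^ 2) := by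
    rw [e1]
    field_simp
  constructor <;> (try rw [hden]) <;>
    simp only [hN1, hN2, phi_neg_natCast, e1, e2, e3, e4]
  · linear_combination hbl1
  -- `bl2` and `bl2_aux` come from `hs` and `hdiff` by eliminating one or the other of the two
  -- products on their left-hand sides.
  · linear_combination hs - a₀ ^ 2 * (((q ^ 2)⁻¹) ^ ν)⁻¹ * hdiff
  · linear_combination -hs + ((q ^ 2)⁻¹) ^ (M + 1) * hdiff
  · linear_combination hbl3
  · linear_combination hbl3a
  · linear_combination hbl4
  · linear_combination hbl5
  · linear_combination hbl6

end

/-! ### From the bilinear equations to the Painlevé system. -/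

/-- The `q`-Painlevé IV system follows from the bilinear equations. -/
theorem satisfiesQPIV_of_bilinearEquations {q a₀ a₁ a₂ : ℂ} (hq : q ≠ 0) (ha₀ : a₀ ≠ 0)
    (ha₂ : a₂ = 1) (ha : a₀ * a₁ * a₂ = q) {φ : ℤ → ℤ → ℂ → ℂ} {N ν : ℤ} {c : ℂ} (hc : c ≠ 0)
    (h0 : BilinearEquations q a₀ φ N ν c) (h0' : BilinearEquations q a₀ φ N (ν - 1) c)
    (h1 : BilinearEquations q a₀ φ N ν (q * c))
    (h1' : BilinearEquations q a₀ φ N (ν - 1) (q * c))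
    (hφ : ∀ x ∈ ({c, q * c, q ^ 2 * c} : Set ℂ),
      φ (N + 1) ν x ≠ 0 ∧ φ N ν x ≠ 0 ∧ φ N (ν - 1) x ≠ 0) :
    SatisfiesQPIV q a₀ a₁ a₂ N ν (f0 q a₀ φ N ν) (f1 q a₀ φ N ν) (f2 q φ N ν) c := by
  subst ha₂
  obtain rfl : a₁ = q / a₀ := by
    field_simp
    linear_combination ha
  obtain ⟨hA, hB, hE⟩ := hφ c (by simp)
  obtain ⟨hA1, hB1, hE1⟩ := hφ (q * c) (by simp)
  obtain ⟨hA2, hB2, hE2⟩ := hφ (q ^ 2 * c) (by simp)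
  have b1 := h0.bl1
  have b2' := h0'.bl2
  have b3' := h0'.bl3
  have b4 := h1.bl4
  have b5' := h1'.bl5
  have b6' := h1'.bl6
  have hqq : q * (q * c) = q ^ 2 * c := by ring
  have hqi : q⁻¹ * (q * c) = c := inv_mul_cancel_left₀ hq c
  simp only [hqq, hqi, sub_add_cancel] at b2' b3' b4 b5' b6'
  have ew : q ^ (2 * ν) = (q ^ ν) ^ 2 := by rw [mul_comm, _root_.zpow_mul]; rfl
  have eo : q ^ (2 * N) = (q ^ N) ^ 2 := by rw [mul_comm, _root_.zpow_mul]; rfl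
  have eo' : q ^ (-2 * N) = ((q ^ N) ^ 2)⁻¹ := by rw [neg_mul, _root_.zpow_neg, eo]
  have ew' : q ^ (2 * (ν - 1)) = (q ^ ν) ^ 2 / q ^ 2 := by
    rw [mul_sub, zpow_sub₀ hq, ew]; rfl
  have e1 : q ^ (ν + N - 1) = q ^ ν * q ^ N / q := by
    rw [zpow_sub_one₀ hq, zpow_add₀ hq, div_eq_mul_inv]
  have e2 : q ^ (-ν + N) = q ^ N / q ^ ν := by
    rw [zpow_add₀ hq, _root_.zpow_neg]; ring
  have e3 : q ^ (ν - N) = q ^ ν / q ^ N := zpow_sub₀ hq _ _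
  have e4 : q ^ (-N) = (q ^ N)⁻¹ := _root_.zpow_neg q N
  have e5 : q ^ (-ν) = (q ^ ν)⁻¹ := _root_.zpow_neg q ν
  simp only [ew, eo, eo', ew'] at b1 b2' b3' b4 b5' b6'
  have hw : q ^ ν ≠ 0 := zpow_ne_zero _ hq
  have ho : q ^ N ≠ 0 := zpow_ne_zero _ hq
  have hW : (q ^ ν) ^ 2 / q ^ 2 * q ^ 2 = (q ^ ν) ^ 2 := div_mul_cancel₀ _ (pow_ne_zero _ hq)
  have hO : ((q ^ N) ^ 2)⁻¹ * (q ^ N) ^ 2 = 1 := inv_mul_cancel₀ (pow_ne_zero _ ho)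
  have d0 : 1 + a₀ * q ^ ν * f0 q a₀ φ N ν c + a₀ * (q / a₀) * q ^ N * f0 q a₀ φ N ν c
      * f1 q a₀ φ N ν c = ((q ^ N) ^ 2)⁻¹ * (φ N (ν - 1) c * φ (N + 1) ν (q ^ 2 * c))
        / (φ (N + 1) ν (q * c) * φ N (ν - 1) (q * c)) := by
    simp only [f0, f1, e1]
    -- Eliminates `φ (N + 1) (ν - 1) (q * c)` between `bl5` at `q * c` and `bl2` at `c`, both with
    -- index `ν - 1`.
    have key : φ (N + 1) ν (q * c) * φ N ν c * φ N (ν - 1) (q * c)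
        + a₀ ^ 2 * (q ^ ν) ^ 2 * c ^ 2 * φ (N + 1) ν c * φ N ν (q * c) * φ N (ν - 1) (q * c)
        - c ^ 2 * q ^ 2 * φ (N + 1) ν (q * c) * φ N ν (q * c) * φ N (ν - 1) c
        = ((q ^ N) ^ 2)⁻¹ * (φ N (ν - 1) c * φ (N + 1) ν (q ^ 2 * c)) * φ N ν c := by
      linear_combination φ N ν c * b5' + (q * c) ^ 2 * φ N ν (q * c) * b2'
        - a₀ ^ 2 * c ^ 2 * φ (N + 1) ν c * φ N ν (q * c) * φ N (ν - 1) (q * c) * hW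
    generalize ((q ^ N) ^ 2)⁻¹ * (φ N (ν - 1) c * φ (N + 1) ν (q ^ 2 * c)) = Y at *
    generalize φ (N + 1) ν (q * c) = A1 at *
    generalize φ N ν (q * c) = B1 at *
    generalize φ N (ν - 1) (q * c) = E1 at *
    field_simp
    linear_combination key
  have d1 : 1 + q / a₀ * q ^ (-ν + N) * f1 q a₀ φ N ν c
      + q / a₀ * 1 * q ^ (-ν) * f1 q a₀ φ N ν c * f2 q φ N ν c
      = φ N ν c * φ N (ν - 1) (q ^ 2 * c) / (φ N (ν - 1) (q * c) * φ N ν (q * c)) := by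
    simp only [f1, f2, e1, e2, e5]
    -- Eliminates `φ (N - 1) (ν - 1) (q * c)` between `bl6` at `q * c` and `bl3` at `c`, both with
    -- index `ν - 1`.
    have key : a₀ ^ 2 * (q ^ ν) ^ 2 * φ (N + 1) ν c * φ N (ν - 1) (q * c) * φ N ν (q * c)
        - q ^ 2 * φ (N + 1) ν (q * c)
          * (φ N (ν - 1) c * φ N ν (q * c) - φ N ν c * φ N (ν - 1) (q * c))
        = a₀ ^ 2 * (q ^ ν) ^ 2 * φ (N + 1) ν c * (φ N ν c * φ N (ν - 1) (q ^ 2 * c)) := by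
      linear_combination q ^ 2 * φ (N + 1) ν c * b6' - q ^ 2 * φ (N + 1) ν (q * c) * b3'
        + a₀ ^ 2 * φ (N + 1) ν c * (φ N ν c * φ N (ν - 1) (q ^ 2 * c)
          - φ N (ν - 1) (q * c) * φ N ν (q * c)) * hW
    generalize φ (N + 1) ν (q * c) = A1 at *
    generalize φ N ν (q * c) = B1 at *
    generalize φ N (ν - 1) (q * c) = E1 at *
    generalize φ N (ν - 1) (q ^ 2 * c) = E2 at *
    field_simp
    linear_combination key
  have d2 : 1 + 1 * q ^ (-N) * f2 q φ N ν c
      + 1 * a₀ * q ^ (ν - N) * f2 q φ N ν c * f0 q a₀ φ N ν c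
      = -(((q ^ N) ^ 2)⁻¹ * a₀ ^ 2 * c ^ 2 * (q ^ ν) ^ 2
          * (φ (N + 1) ν c * φ N ν (q ^ 2 * c)) / (φ N ν (q * c) * φ (N + 1) ν (q * c))) := by
    simp only [f0, f2, e3, e4]
    -- Eliminates `φ (N + 1) (ν + 1) (q * c)` between `bl1` at `c` and `bl4` at `q * c`, both with
    -- index `ν`.
    have key : φ N ν (q * c) * φ N (ν - 1) c * φ (N + 1) ν (q * c)
        - φ N (ν - 1) (q * c) * (φ N ν c * φ (N + 1) ν (q * c)
          + a₀ ^ 2 * (q ^ ν) ^ 2 * c ^ 2 * φ (N + 1) ν c * φ N ν (q * c))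
        = -(((q ^ N) ^ 2)⁻¹ * a₀ ^ 2 * c ^ 2 * (q ^ ν) ^ 2
          * (φ (N + 1) ν c * φ N ν (q ^ 2 * c))) * φ N (ν - 1) c := by
      linear_combination -φ N (ν - 1) (q * c) * b1 + ((q ^ N) ^ 2)⁻¹ * φ N (ν - 1) c * b4
        - φ N (ν - 1) c * φ N ν (q * c) * φ (N + 1) ν (q * c) * hO
        - ((q ^ N) ^ 2)⁻¹ * φ N (ν - 1) c * a₀ ^ 2 * c ^ 2 * φ (N + 1) ν c * φ N ν (q ^ 2 * c) * hW
    rw [← neg_div]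
    generalize -(((q ^ N) ^ 2)⁻¹ * a₀ ^ 2 * c ^ 2 * (q ^ ν) ^ 2
      * (φ (N + 1) ν c * φ N ν (q ^ 2 * c))) = Y at *
    generalize φ (N + 1) ν (q * c) = A1 at *
    generalize φ N ν (q * c) = B1 at *
    generalize φ N (ν - 1) (q * c) = E1 at *
    field_simp
    linear_combination key
  have n0 : ((q ^ N) ^ 2)⁻¹ * (φ N (ν - 1) c * φ (N + 1) ν (q ^ 2 * c))
        / (φ (N + 1) ν (q * c) * φ N (ν - 1) (q * c)) ≠ 0 := by positivity
  have n1 : φ N ν c * φ N (ν - 1) (q ^ 2 * c) / (φ N (ν - 1) (q * c) * φ N ν (q * c)) ≠ 0 := by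
    positivity
  have n2 : -(((q ^ N) ^ 2)⁻¹ * a₀ ^ 2 * c ^ 2 * (q ^ ν) ^ 2
          * (φ (N + 1) ν c * φ N ν (q ^ 2 * c)) / (φ N ν (q * c) * φ (N + 1) ν (q * c))) ≠ 0 :=
    neg_ne_zero.mpr (by positivity)
  refine ⟨?_, ?_, ?_, ?_, ?_, ?_, ?_⟩
  · rwa [d0]
  · rwa [d1]
  · rwa [d2]
  · rw [d0, d2]
    simp only [f0, f1, e1, hqq]
    field_simp
  · rw [d0, d1]
    simp only [f1, f2, e1, e5, hqq]
    field_simp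
  · rw [d1, d2]
    simp only [f0, f2, e3, hqq]
    field_simp
  · simp only [f0, f1, f2, e1]
    generalize φ (N + 1) ν (q * c) = A1 at *
    generalize φ N ν (q * c) = B1 at *
    generalize φ N (ν - 1) (q * c) = E1 at *
    field_simp

end QPIV

theorem mainTheorem5 (q a₀ a₁ a₂ : ℂ) (hq : q ≠ 0) (ha₀ : a₀ ≠ 0)
    (ha₂ : a₂ = 1) (ha : a₀ * a₁ * a₂ = q)
    (D : Set ℂ) (hD0 : (0 : ℂ) ∉ D) (hD : ∀ c ∈ D, q * c ∈ D ∧ q⁻¹ * c ∈ D)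
    (G : ℤ → ℂ → ℂ) (hG : QPIV.ContiguityRelations q a₀ D G) :
    (∀ N : ℤ, N < 0 → ∀ ν : ℤ, ∀ c ∈ D,
      QPIV.BilinearEquations q a₀ (QPIV.phi G) N ν c) ∧
    (∀ N : ℤ, N < 0 → ∀ ν : ℤ, ∀ c ∈ D,
      (∀ x ∈ ({c, q * c, q ^ 2 * c} : Set ℂ),
        QPIV.phi G (N + 1) ν x ≠ 0 ∧ QPIV.phi G N ν x ≠ 0 ∧ QPIV.phi G N (ν - 1) x ≠ 0) →
      QPIV.SatisfiesQPIV q a₀ a₁ a₂ N ν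
        (QPIV.f0 q a₀ (QPIV.phi G) N ν) (QPIV.f1 q a₀ (QPIV.phi G) N ν)
        (QPIV.f2 q (QPIV.phi G) N ν) c) := by
  have hbl : ∀ N : ℤ, N < 0 → ∀ ν : ℤ, ∀ c ∈ D,
      QPIV.BilinearEquations q a₀ (QPIV.phi G) N ν c := fun N hN ν c hc =>
    QPIV.bilinearEquations_phi hq ha₀ hD0 (fun c hc => (hD c hc).2) hG hN ν hc
  refine ⟨hbl, fun N hN ν c hc hφ => ?_⟩
  have hqc := (hD c hc).1
  exact QPIV.satisfiesQPIV_of_bilinearEquations hq ha₀ ha₂ ha (fun h => hD0 (h ▸ hc))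
    (hbl N hN ν c hc) (hbl N hN (ν - 1) c hc) (hbl N hN ν _ hqc) (hbl N hN (ν - 1) _ hqc) hφ
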